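/- A subset of a topological space is Lindelöf if each of its open covers has a countable subcover. An \emph{LLSP space} is a Hausdorff space $X$ such that every point has a Lindelöf neighbourhood, every intersection of countably many open sets is open, and $X$ is scattered. Here the Cantor--Bendixson levels of $X$ are defined by recursion on ordinals: $I_\alpha(X)$ is the set of isolated points of the subspace $X\setminus\bigcup\{I_\beta(X):\beta<\alpha\}$; and $X$ is \emph{scattered} if $X=\bigcup\{I_\beta(X):\beta<\alpha\}$ for some ordinal $\alpha$. The \emph{cardinal sequence} of a scattered space $X$ is $\langle |I_\alpha(X)|:\alpha<\delta\rangle$, where $\delta$ is the least ordinal $\gamma$ such that $I_\gamma(X)$ is finite. For cardinals $\omega\le\lambda\le\kappa$, let $\mathbb A(\kappa,\lambda)$ be the least cardinal $\mu$ such that every family of exactly $\mu$ subsets of $\kappa$, each of cardinality $\lambda$, has two distinct members $A_0,A_1$ with $|A_0\cap A_1|=\lambda$. Let $\mathbb I(\kappa,\lambda)$ be the least cardinal $\mu$ such that every family $\mathcal I$ of exactly $\mu$ subsets of $\kappa$, each of cardinality at most $\lambda$, has a member $A$ with $A\subseteq\bigcup\mathcal J$ for some countably infinite $\mathcal J\subseteq\mathcal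 I\setminus\{A\}$. \textbf{Theorem.} Let $\vec\kappa=\langle\kappa_\alpha:\alpha<\omega_2\rangle$ be a sequence of uncountable cardinals. (1) If $\kappa_\beta<\mathbb A(\kappa_\alpha,\omega_1)$ for all $\alpha<\beta<\omega_2$, then $\vec\kappa$ is the cardinal sequence of an LLSP space. (2) If $\vec\kappa$ is the cardinal sequence of an LLSP space, then $\kappa_\beta<\mathbb I(\kappa_\alpha,\kappa_\alpha)$ for all $\alpha<\beta<\omega_2$. -/

import Mathlib

universe u

open Cardinal Ordinal Topology

/-- The isolated points of the subspace `Y` of `X`. -/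
def isolatedPoints {X : Type u} [TopologicalSpace X] (Y : Set X) : Set X :=
  {x | ∃ V : Set X, IsOpen V ∧ V ∩ Y = {x}}

/-- The Cantor-Bendixson level `I_α(X)`: the set of isolated points of
`X \ ⋃ {I_β(X) : β < α}`. -/
def cbLevel (X : Type u) [TopologicalSpace X] (α : Ordinal.{u}) : Set X :=
  isolatedPoints (⋃ β : Set.Iio α, cbLevel X β.1)ᶜ
termination_by α
decreasing_by exact β.2

/-- `X` is the union of its Cantor-Bendixson levels below some ordinal. -/
def IsScatteredSpace (X : Type u) [TopologicalSpace X] : Prop :=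
  ∃ α : Ordinal.{u}, (⋃ β : Set.Iio α, cbLevel X β.1) = Set.univ

/-- P-spaces: countable intersections of open sets are open. -/
def IsPSpace (X : Type u) [TopologicalSpace X] : Prop :=
  ∀ S : Set (Set X), S.Countable → (∀ V ∈ S, IsOpen V) → IsOpen (⋂₀ S)

/-- Locally Lindelöf, scattered, Hausdorff P-spaces. -/
structure IsLLSPSpace (X : Type u) [TopologicalSpace X] : Prop where
  hausdorff : T2Space X
  locally_lindelof : ∀ x : X, ∃ L ∈ 𝓝 x, IsLindelof L
  scattered : IsScatteredSpace X
  pspace : IsPSpace X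

/-- `CS(X) = ⟨s_α : α < δ⟩`: the ordinal `δ` is the least `γ` such that `I_γ(X)` is finite, and
`s_α = |I_α(X)|` for all `α < δ`. -/
def HasCardinalSequence (X : Type u) [TopologicalSpace X] {δ : Ordinal.{u}}
    (s : Set.Iio δ → Cardinal.{u}) : Prop :=
  IsLeast {γ : Ordinal.{u} | (cbLevel X γ).Finite} δ ∧
    ∀ α : Set.Iio δ, #(cbLevel X α.1) = s α

/-- The sequence `s` is the cardinal sequence of some LLSP space. -/
def IsLLSPCardinalSequence {δ : Ordinal.{u}} (s : Set.Iio δ → Cardinal.{u}) : Prop :=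
  ∃ (X : Type u) (_ : TopologicalSpace X), IsLLSPSpace X ∧ HasCardinalSequence X s

/-- `𝔸(κ, l)`: the least `μ` such that every family of exactly `μ` subsets of `κ` of size `l`
has two distinct members whose intersection has size `l`.
The type `κ.out` is a set of cardinality `κ`. -/
noncomputable def almostDisjointNumber (κ l : Cardinal.{u}) : Cardinal.{u} :=
  sInf {μ | ∀ F : Set (Set κ.out), (∀ A ∈ F, #A = l) → #F = μ →
    ∃ A ∈ F, ∃ B ∈ F, A ≠ B ∧ #(A ∩ B : Set κ.out) = l}

/-- `𝕀(κ, l)`: the least `μ` such that every family of exactly `μ` subsets of `κ` of size at most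
`l` has a member covered by the union of countably infinitely many other members. -/
noncomputable def countableCoverNumber (κ l : Cardinal.{u}) : Cardinal.{u} :=
  sInf {μ | ∀ F : Set (Set κ.out), (∀ A ∈ F, #A ≤ l) → #F = μ →
    ∃ A ∈ F, ∃ J ⊆ F \ {A}, #J = ℵ₀ ∧ A ⊆ ⋃₀ J}

/-!
The necessity part uses that in an LLSP space every point has arbitrarily small closed
neighbourhoods. Choose for each `x ∈ I_β` a closed neighbourhood `C x` meeting `I_β` in `x` only.
Countable unions of closed sets are closed in a P-space, so removing from `C x` countably many
other `C y` leaves a neighbourhood of `x`, which meets `I_α` since the space is scattered. Hence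
the traces `C x ∩ I_α` witness `κ_β < 𝕀(κ_α, κ_α)` (`IsLLSPSpace.exists_trace`,
`lt_countableCoverNumber`).

For sufficiency, a ranked partial order becomes a topological space in which a neighbourhood of
`x` is its cone `Set.Iic x` minus countably many smaller cones. If any two cones meet in a
countable union of cones, and a cone minus countably many smaller ones still has points of every
rank below its top, the space is LLSP, its cones are Lindelöf and clopen, and its levels are the
sets of points of equal rank (`IsConeSystem`).

Such an order is obtained from a set of nodes, each with at most one child, of smaller rank, in
every column of a fixed set (`ColumnSystem`). Its points are nodes placed at finite sequences of
columns, and below the node `q` at `s` lie the points reached from `q` by descending through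
columns, which are appended to `s`. Points at incompatible addresses have disjoint cones, and
distinct nodes are made to share only countably many columns, so by induction on the rank two
cones meet in a countable union of cones (`ColumnSystem.exists_countable_common`).

It remains to choose the columns (`levelColumnSystem`). There are `κ_γ` nodes of rank `γ`, each
with `ω₁` columns `(a m, g m, m)` coded by `m < ω₁`; as `γ < ω₂`, every rank below `γ` can be
assigned to uncountably many `m`. The function `g : ω₁ → ω₁` depends on `γ` only, and functions of
different ranks agree at countably many places. The function `a` comes from an almost disjoint
family of `κ_γ` subsets of the least `κ_α`, `α < γ`, and separates nodes of the same rank. Taking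
`κ_α` least keeps the addresses of each rank `δ` made of at most `κ_δ` columns, so there are
exactly `κ_δ` points of rank `δ`.
-/

/-! ### Cantor–Bendixson levels -/

theorem cbLevel_eq {X : Type u} [TopologicalSpace X] (α : Ordinal.{u}) :
    cbLevel X α = isolatedPoints (⋃ β : Set.Iio α, cbLevel X β.1)ᶜ := by
  rw [cbLevel]

theorem isolatedPoints_subset {X : Type u} [TopologicalSpace X] (Y : Set X) :
    isolatedPoints Y ⊆ Y := by
  rintro x ⟨V, -, hV⟩
  have : x ∈ V ∩ Y := hV ▸ rfl
  exact this.2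

/-- In a scattered space every point of a level is a limit of each lower level. -/
theorem IsScatteredSpace.inter_cbLevel_nonempty {X : Type u} [TopologicalSpace X]
    (hX : IsScatteredSpace X) {α β : Ordinal.{u}} (hαβ : α < β) {x : X} (hx : x ∈ cbLevel X β)
    {V : Set X} (hV : IsOpen V) (hxV : x ∈ V) : (V ∩ cbLevel X α).Nonempty := by
  obtain ⟨o, ho⟩ := hX
  have hlev : ∀ y : X, ∃ ε, y ∈ cbLevel X ε := fun y ↦ by
    have : y ∈ ⋃ γ : Set.Iio o, cbLevel X γ.1 := ho ▸ Set.mem_univ y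
    obtain ⟨γ, hγ⟩ := Set.mem_iUnion.1 this
    exact ⟨γ, hγ⟩
  -- A point of least level among those of `V` outside the levels below `α` is isolated there.
  let S : Set Ordinal.{u} := {ε | ∃ y ∈ V, (∀ γ < α, y ∉ cbLevel X γ) ∧ y ∈ cbLevel X ε}
  have hS : S.Nonempty := by
    refine ⟨β, x, hxV, fun γ hγ hxγ ↦ ?_, hx⟩
    have := isolatedPoints_subset _ ((cbLevel_eq (X := X) β) ▸ hx)
    exact this (Set.mem_iUnion.2 ⟨⟨γ, hγ.trans hαβ⟩, hxγ⟩)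
  obtain ⟨y, hyV, hyα, hy⟩ := csInf_mem hS
  set ε := sInf S
  refine ⟨y, hyV, ?_⟩
  rw [cbLevel_eq] at hy ⊢
  obtain ⟨W, hW, hWy⟩ := hy
  refine ⟨W ∩ V, hW.inter hV, Set.eq_singleton_iff_unique_mem.2 ⟨⟨⟨?_, hyV⟩, ?_⟩, ?_⟩⟩
  · exact (hWy.ge rfl).1
  · simpa using hyα
  · rintro z ⟨⟨hzW, hzV⟩, hz⟩
    have hzα : ∀ γ < α, z ∉ cbLevel X γ := by simpa using hz
    have : z ∈ W ∩ (⋃ β : Set.Iio ε, cbLevel X β.1)ᶜ := by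
      refine ⟨hzW, ?_⟩
      simp only [Set.mem_compl_iff, Set.mem_iUnion, not_exists]
      exact fun γ hγ ↦ (csInf_le' (show γ.1 ∈ S from ⟨z, hzV, hzα, hγ⟩)).not_gt γ.2
    rw [hWy] at this
    exact this

/-! ### Closed neighbourhoods in LLSP spaces -/

theorem IsPSpace.isClosed_sUnion {X : Type u} [TopologicalSpace X] (hX : IsPSpace X)
    {S : Set (Set X)} (hS : S.Countable) (h : ∀ C ∈ S, IsClosed C) : IsClosed (⋃₀ S) := by
  rw [← isOpen_compl_iff, Set.compl_sUnion]
  refine hX _ (hS.image _) ?_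
  rintro _ ⟨C, hC, rfl⟩
  exact (h C hC).isOpen_compl

/-- In a Hausdorff P-space, points can be separated from Lindelöf sets by open sets. -/
theorem IsPSpace.exists_isOpen_disjoint {X : Type u} [TopologicalSpace X] [T2Space X]
    (hX : IsPSpace X) {K : Set X} (hK : IsLindelof K) {x : X} (hx : x ∉ K) :
    ∃ U W : Set X, IsOpen U ∧ IsOpen W ∧ x ∈ U ∧ K ⊆ W ∧ Disjoint U W := by
  have hsep : ∀ y : X, ∃ U W : Set X, IsOpen U ∧ IsOpen W ∧ x ∈ U ∧ (y ≠ x → y ∈ W) ∧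
      Disjoint U W := fun y ↦ by
    by_cases h : y = x
    · exact ⟨Set.univ, ∅, isOpen_univ, isOpen_empty, trivial, fun h' ↦ (h' h).elim, by simp⟩
    · obtain ⟨U, W, hU, hW, hxU, hyW, hd⟩ := t2_separation (Ne.symm h)
      exact ⟨U, W, hU, hW, hxU, fun _ ↦ hyW, hd⟩
  choose U W hU hW hxU hyW hd using hsep
  obtain ⟨t, ht, hKt⟩ := hK.elim_countable_subcover W hW
    (fun y hy ↦ Set.mem_iUnion.2 ⟨y, hyW y fun h ↦ hx (h ▸ hy)⟩)
  refine ⟨⋂₀ (U '' t), ⋃ i ∈ t, W i, hX _ (ht.image _) ?_, isOpen_biUnion fun i _ ↦ hW i, ?_,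
    hKt, ?_⟩
  · rintro _ ⟨y, -, rfl⟩
    exact hU y
  · rintro _ ⟨y, -, rfl⟩
    exact hxU y
  · rw [Set.disjoint_iUnion₂_right]
    exact fun y hy ↦ (hd y).mono_left (Set.sInter_subset_of_mem ⟨y, hy, rfl⟩)

theorem IsLLSPSpace.exists_isClosed_subset {X : Type u} [TopologicalSpace X]
    (hX : IsLLSPSpace X) {x : X} {V : Set X} (hV : V ∈ 𝓝 x) :
    ∃ C ∈ 𝓝 x, IsClosed C ∧ C ⊆ V := by
  have := hX.hausdorff
  obtain ⟨L, hL, hLin⟩ := hX.locally_lindelof x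
  have hLc : IsClosed L := by
    rw [← isOpen_compl_iff, isOpen_iff_mem_nhds]
    intro y hy
    obtain ⟨U, W, hU, -, hyU, hLW, hd⟩ := hX.pspace.exists_isOpen_disjoint hLin hy
    exact Filter.mem_of_superset (hU.mem_nhds hyU)
      fun z hz hzL ↦ Set.disjoint_left.1 hd hz (hLW hzL)
  have hK : IsLindelof (L \ interior V) := hLin.diff isOpen_interior
  obtain ⟨U, W, hU, hW, hxU, hKW, hd⟩ := hX.pspace.exists_isOpen_disjoint hK
    (fun h ↦ h.2 (mem_interior_iff_mem_nhds.2 hV))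
  refine ⟨L \ W, ?_, hLc.sdiff hW, fun z hz ↦ ?_⟩
  · filter_upwards [hL, hU.mem_nhds hxU] with z hz hzU
    exact ⟨hz, Set.disjoint_left.1 hd hzU⟩
  · by_contra hzV
    exact hz.2 (hKW ⟨hz.1, fun h ↦ hzV (interior_subset h)⟩)

/-- The traces on a lower level of suitable closed neighbourhoods of the points of level `β`:
no trace is covered by countably many traces of other points. -/
theorem IsLLSPSpace.exists_trace {X : Type u} [TopologicalSpace X] (hX : IsLLSPSpace X)
    {α β : Ordinal.{u}} (hαβ : α < β) : ∃ A : cbLevel X β → Set (cbLevel X α),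
      ∀ x, ∀ T : Set (cbLevel X β), T.Countable → x ∉ T → ¬ A x ⊆ ⋃ y ∈ T, A y := by
  have hC : ∀ x : cbLevel X β, ∃ C ∈ 𝓝 x.1, IsClosed C ∧ C ∩ cbLevel X β ⊆ {x.1} := by
    rintro ⟨x, hx⟩
    have hx' := hx
    rw [cbLevel_eq] at hx'
    obtain ⟨V, hV, hVx⟩ := hx'
    have hxV : x ∈ V := (hVx.ge rfl).1
    obtain ⟨C, hC, hCc, hCV⟩ := hX.exists_isClosed_subset (hV.mem_nhds hxV)
    refine ⟨C, hC, hCc, fun y hy ↦ ?_⟩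
    rw [← hVx]
    exact ⟨hCV hy.1, isolatedPoints_subset _ ((cbLevel_eq (X := X) β) ▸ hy.2)⟩
  choose C hCn hCc hCx using hC
  refine ⟨fun x ↦ {z | z.1 ∈ C x}, fun x T hT hxT hsub ↦ ?_⟩
  have hcl : IsClosed (⋃₀ (C '' T)) := hX.pspace.isClosed_sUnion (hT.image _) (by
    rintro _ ⟨y, -, rfl⟩
    exact hCc y)
  obtain ⟨z, ⟨hz, hzT⟩, hzα⟩ := hX.scattered.inter_cbLevel_nonempty hαβ x.2
    (V := interior (C x) \ ⋃₀ (C '' T)) (isOpen_interior.sdiff hcl)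
    ⟨mem_interior_iff_mem_nhds.2 (hCn x), by
      rintro ⟨_, ⟨y, hy, rfl⟩, hxy⟩
      have : x = y := Subtype.ext (hCx y ⟨hxy, x.2⟩)
      exact hxT (this ▸ hy)⟩
  have := hsub (show (⟨z, hzα⟩ : cbLevel X α) ∈ _ from
    interior_subset (s := C x) hz)
  simp only [Set.mem_iUnion, Set.mem_ofPred_eq] at this
  obtain ⟨y, hy, hzy⟩ := this
  exact hzT ⟨_, ⟨y, hy, rfl⟩, hzy⟩

/-- A family in which no member is covered by countably many others bounds `𝕀(κ, κ)` from below.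
The covering property passes to larger families, so it fails for all smaller ones. -/
theorem lt_countableCoverNumber {κ μ : Cardinal.{u}} {I : Type u} (hI : #I = μ)
    (A : I → Set κ.out)
    (hA : ∀ x, ∀ T : Set I, T.Countable → x ∉ T → ¬ A x ⊆ ⋃ y ∈ T, A y) :
    μ < countableCoverNumber κ κ := by
  have hinj : Function.Injective A := by
    intro x y hxy
    by_contra hne
    exact hA x {y} (Set.countable_singleton y) hne (by simp [hxy])
  have hne : {ν : Cardinal.{u} | ∀ F : Set (Set κ.out), (∀ A ∈ F, #A ≤ κ) → #F = ν →
      ∃ A ∈ F, ∃ J ⊆ F \ {A}, #J = ℵ₀ ∧ A ⊆ ⋃₀ J}.Nonempty := by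
    refine ⟨Order.succ #(Set κ.out), fun F _ hF ↦ absurd (mk_set_le F) ?_⟩
    rw [hF, not_le]
    exact Order.lt_succ _
  by_contra! hle
  have hmem := csInf_mem hne
  change countableCoverNumber κ κ ∈ _ at hmem
  obtain ⟨S, hS⟩ : ∃ S : Set I, #S = countableCoverNumber κ κ :=
    le_mk_iff_exists_set.1 (hI ▸ hle)
  obtain ⟨_, ⟨x, hx, rfl⟩, J, hJ, hJc, hcov⟩ := hmem (A '' S)
    (fun B _ ↦ (mk_set_le B).trans (mk_out κ).le) ((mk_image_eq hinj).trans hS)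
  have hJ' : J.Countable := by
    rw [← le_aleph0_iff_set_countable]
    exact hJc.le
  refine hA x (A ⁻¹' J) (hJ'.preimage hinj) (fun h ↦ (hJ h).2 rfl) (hcov.trans ?_)
  rintro z ⟨B, hB, hz⟩
  obtain ⟨y, -, rfl⟩ := (hJ hB).1
  exact Set.mem_biUnion (show y ∈ A ⁻¹' J from hB) hz

theorem lt_countableCoverNumber_of_isLLSPCardinalSequence {δ : Ordinal.{u}}
    {κ : Set.Iio δ → Cardinal.{u}} (h : IsLLSPCardinalSequence κ) {α β : Set.Iio δ}
    (hαβ : α < β) : κ β < countableCoverNumber (κ α) (κ α) := by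
  obtain ⟨X, _, hX, -, hκ⟩ := h
  obtain ⟨A, hA⟩ := hX.exists_trace (show α.1 < β.1 from hαβ)
  obtain ⟨e⟩ : Nonempty (cbLevel X α.1 ≃ (κ α).out) := by
    rw [← Cardinal.eq, hκ, mk_out]
  refine lt_countableCoverNumber (hκ β) (fun x ↦ e '' A x) fun x T hT hxT hsub ↦
    hA x T hT hxT ?_
  rwa [← Set.image_iUnion₂, Set.image_subset_image_iff e.injective] at hsub

/-! ### Spaces from partial orders -/

/-- The topology of a partial order in which a basic neighbourhood of `x` is the cone `Set.Iic x`
minus the cones of countably many points strictly below `x`. -/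
@[reducible]
def coneTopology (P : Type u) [PartialOrder P] : TopologicalSpace P where
  IsOpen V := ∀ x ∈ V, ∃ F : Set P, F.Countable ∧ F ⊆ Set.Iio x ∧
    ∀ y ≤ x, (∀ z ∈ F, ¬ y ≤ z) → y ∈ V
  isOpen_univ := fun _ _ ↦ ⟨∅, Set.countable_empty, Set.empty_subset _, fun _ _ _ ↦ trivial⟩
  isOpen_inter := by
    rintro V W hV hW x ⟨hxV, hxW⟩
    obtain ⟨F, hF, hFx, hFV⟩ := hV x hxV
    obtain ⟨G, hG, hGx, hGW⟩ := hW x hxW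
    exact ⟨F ∪ G, hF.union hG, Set.union_subset hFx hGx, fun y hy h ↦
      ⟨hFV y hy fun z hz ↦ h z (Or.inl hz), hGW y hy fun z hz ↦ h z (Or.inr hz)⟩⟩
  isOpen_sUnion := by
    rintro S hS x ⟨V, hV, hxV⟩
    obtain ⟨F, hF, hFx, hFV⟩ := hS V hV x hxV
    exact ⟨F, hF, hFx, fun y hy h ↦ ⟨V, hV, hFV y hy h⟩⟩

/-- A partial order ranked by ordinals below `o`, in which two cones meet in a countable union of
cones, and a cone with countably many smaller cones removed still has points of every rank below
that of its top. -/
structure IsConeSystem (P : Type u) [PartialOrder P] (rk : P → Ordinal.{u}) (o : Ordinal.{u}) :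
    Prop where
  rk_lt : ∀ x, rk x < o
  strictMono : StrictMono rk
  inter : ∀ x y : P, ∃ F : Set P, F.Countable ∧ ∀ z, (z ≤ x ∧ z ≤ y) ↔ ∃ w ∈ F, z ≤ w
  dense : ∀ x, ∀ α < rk x, ∀ F : Set P, F.Countable → F ⊆ Set.Iio x →
    ∃ y ≤ x, rk y = α ∧ ∀ z ∈ F, ¬ y ≤ z

namespace IsConeSystem

variable {P : Type u} [PartialOrder P] {rk : P → Ordinal.{u}} {o : Ordinal.{u}}

theorem isOpen_Iic (x : P) : IsOpen[coneTopology P] (Set.Iic x) := fun _ hy ↦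
  ⟨∅, Set.countable_empty, Set.empty_subset _, fun _ hz _ ↦ hz.trans hy⟩

theorem isClosed_Iic (h : IsConeSystem P rk o) (x : P) :
    IsClosed[coneTopology P] (Set.Iic x) := by
  let := coneTopology P
  rw [← isOpen_compl_iff]
  intro y hy
  obtain ⟨F, hF, hFy⟩ := h.inter x y
  refine ⟨F, hF, fun w hw ↦ ?_, fun z hzy hzF hzx ↦ ?_⟩
  · obtain ⟨hwx, hwy⟩ := (hFy w).2 ⟨w, hw, le_rfl⟩
    exact lt_of_le_of_ne hwy (by rintro rfl; exact hy hwx)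
  · obtain ⟨w, hw, hzw⟩ := (hFy z).1 ⟨hzx, hzy⟩
    exact hzF w hw hzw

theorem isPSpace : @IsPSpace P (coneTopology P) := by
  let := coneTopology P
  intro S hS hSo x hx
  choose! F hF hFx hFV using fun V (hV : V ∈ S) ↦ hSo V hV x (hx V hV)
  refine ⟨⋃ V ∈ S, F V, hS.biUnion hF, Set.iUnion₂_subset hFx, fun y hy h V hV ↦ ?_⟩
  exact hFV V hV y hy fun z hz ↦ h z (Set.mem_biUnion hV hz)

theorem t2Space (h : IsConeSystem P rk o) : @T2Space P (coneTopology P) := by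
  let := coneTopology P
  have key : ∀ x y : P, ¬ x ≤ y → ∃ U V : Set P, IsOpen U ∧ IsOpen V ∧ x ∈ U ∧ y ∈ V ∧
      Disjoint U V := fun x y hxy ↦
    ⟨(Set.Iic y)ᶜ, Set.Iic y, (h.isClosed_Iic y).isOpen_compl, isOpen_Iic y, hxy,
      le_rfl, disjoint_compl_left⟩
  refine ⟨fun x y hne ↦ ?_⟩
  by_cases hxy : x ≤ y
  · obtain ⟨U, V, hU, hV, hy, hx, hd⟩ := key y x fun hyx ↦ hne (le_antisymm hxy hyx)
    exact ⟨V, U, hV, hU, hx, hy, hd.symm⟩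
  · exact key x y hxy

/-- By induction on the rank: a neighbourhood of the top `x` omits only countably many smaller
cones. -/
theorem isLindelof_Iic (h : IsConeSystem P rk o) (x : P) :
    @IsLindelof P (coneTopology P) (Set.Iic x) := by
  let := coneTopology P
  induction x using (InvImage.wf rk wellFounded_lt).induction with
  | _ x ih =>
    refine isLindelof_of_countable_subcover fun U hU hxU ↦ ?_
    obtain ⟨i, hi⟩ := Set.mem_iUnion.1 (hxU (Set.mem_Iic.2 le_rfl))
    obtain ⟨F, hF, hFx, hFU⟩ := hU i x hi
    have hL : IsLindelof (⋃ w ∈ F, Set.Iic w) :=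
      hF.isLindelof_biUnion fun w hw ↦ ih w (h.strictMono (hFx hw))
    obtain ⟨t, ht, hFt⟩ := hL.elim_countable_subcover U hU
      (Set.iUnion₂_subset fun w hw ↦ (Set.Iic_subset_Iic.2 (hFx hw).le).trans hxU)
    refine ⟨insert i t, ht.insert i, fun y hy ↦ ?_⟩
    by_cases hyF : ∃ w ∈ F, y ≤ w
    · obtain ⟨w, hw, hyw⟩ := hyF
      obtain ⟨j, hj, hyj⟩ := Set.mem_iUnion₂.1 (hFt (Set.mem_biUnion hw hyw))
      exact Set.mem_biUnion (Set.mem_insert_of_mem i hj) hyj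
    · exact Set.mem_biUnion (Set.mem_insert i t)
        (hFU y hy fun w hw hyw ↦ hyF ⟨w, hw, hyw⟩)

theorem cbLevel_eq (h : IsConeSystem P rk o) (α : Ordinal.{u}) :
    @cbLevel P (coneTopology P) α = {x | rk x = α} := by
  let := coneTopology P
  induction α using WellFoundedLT.induction with
  | _ α ih =>
    have hc : (⋃ β : Set.Iio α, cbLevel P β.1)ᶜ = {x | α ≤ rk x} := by
      ext x
      simp only [Set.mem_compl_iff, Set.mem_iUnion, not_exists, Set.mem_ofPred_eq]
      constructor
      · intro hx
        by_contra! hlt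
        exact hx ⟨rk x, hlt⟩ (by rw [ih _ hlt]; rfl)
      · rintro hx ⟨β, hβ⟩ hxβ
        rw [ih β hβ] at hxβ
        exact (hx.trans_eq hxβ).not_gt hβ
    rw [_root_.cbLevel_eq, hc]
    ext x
    constructor
    · rintro ⟨V, hV, hVx⟩
      have hx : x ∈ V ∩ {x | α ≤ rk x} := hVx ▸ rfl
      refine le_antisymm ?_ hx.2
      by_contra! hlt
      obtain ⟨F, hF, hFx, hFV⟩ := hV x hx.1
      obtain ⟨y, hyx, hy, hyF⟩ := h.dense x α hlt F hF hFx
      have : y ∈ V ∩ {x | α ≤ rk x} := ⟨hFV y hyx hyF, hy.ge⟩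
      rw [hVx] at this
      obtain rfl : y = x := this
      exact hlt.ne' hy
    · intro hx
      refine ⟨Set.Iic x, isOpen_Iic x, Set.eq_singleton_iff_unique_mem.2
        ⟨⟨le_rfl, hx.ge⟩, fun y hy ↦ ?_⟩⟩
      by_contra hne
      have := h.strictMono (lt_of_le_of_ne hy.1 hne)
      exact (hy.2.trans_lt this).ne' hx

theorem isLLSPSpace (h : IsConeSystem P rk o) : @IsLLSPSpace P (coneTopology P) :=
  let := coneTopology P
  { hausdorff := h.t2Space
    locally_lindelof := fun x ↦ ⟨Set.Iic x, (isOpen_Iic x).mem_nhds le_rfl, h.isLindelof_Iic x⟩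
    scattered := ⟨o, Set.eq_univ_of_forall fun x ↦
      Set.mem_iUnion.2 ⟨⟨rk x, h.rk_lt x⟩, by rw [h.cbLevel_eq]; rfl⟩⟩
    pspace := isPSpace }

theorem isLLSPCardinalSequence (h : IsConeSystem P rk o) {s : Set.Iio o → Cardinal.{u}}
    (hs : ∀ α, ℵ₀ ≤ s α) (hrk : ∀ α : Set.Iio o, #{x | rk x = α.1} = s α) :
    IsLLSPCardinalSequence s := by
  let := coneTopology P
  refine ⟨P, coneTopology P, h.isLLSPSpace, ⟨?_, fun γ hγ ↦ ?_⟩, fun α ↦ ?_⟩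
  · have : cbLevel P o = ∅ := by
      rw [h.cbLevel_eq]
      exact Set.eq_empty_of_forall_notMem fun x hx ↦ (h.rk_lt x).ne hx
    simp [this]
  · by_contra! hlt
    have hfin : {x | rk x = γ}.Finite := by simpa [h.cbLevel_eq] using hγ
    exact (hs ⟨γ, hlt⟩).not_gt (hrk ⟨γ, hlt⟩ ▸ hfin.lt_aleph0)
  · rw [h.cbLevel_eq, hrk]

end IsConeSystem

/-! ### Cone systems of column sequences -/

/-- Descent data: a node `q` of rank `rk q` may have a child in each column `c`; `ch q c p` says
that this child is `p`. The predicate `ok c q` says that column `c` may be used in an address of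
the node `q`. -/
structure ColumnSystem (Q C : Type u) where
  /-- The rank of a node. -/
  rk : Q → Ordinal.{u}
  /-- `ch q c p`: the node `p` is the child of `q` in column `c`. -/
  ch : Q → C → Q → Prop
  /-- `ok c q`: column `c` is admissible for the node `q`. -/
  ok : C → Q → Prop
  ch_unique : ∀ {q c p p'}, ch q c p → ch q c p' → p = p'
  rk_lt : ∀ {q c p}, ch q c p → rk p < rk q
  ok_ch : ∀ {q c p}, ch q c p → ok c p
  ok_mono : ∀ {q c p d}, ch q c p → ok d q → ok d p
  countable_common : ∀ q p, q ≠ p → {c | (∃ q', ch q c q') ∧ ∃ p', ch p c p'}.Countable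
  not_countable_ch : ∀ q, ∀ α < rk q, ¬ {c | ∃ p, rk p = α ∧ ch q c p}.Countable

namespace ColumnSystem

variable {Q C : Type u} (S : ColumnSystem Q C)

/-- `S.Path q u p`: descending from `q` through the columns of `u` leads to `p`. -/
def Path : Q → List C → Q → Prop
  | q, [], p => q = p
  | q, c :: u, p => ∃ q', S.ch q c q' ∧ Path q' u p

variable {S}

theorem Path.append {q p r : Q} {u v : List C} (h : S.Path q u p) (h' : S.Path p v r) :
    S.Path q (u ++ v) r := by
  induction u generalizing q with
  | nil => obtain rfl : q = p := h; exact h'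
  | cons c u ih => obtain ⟨q', hq, hu⟩ := h; exact ⟨q', hq, ih hu⟩

theorem Path.rk_le {q p : Q} {u : List C} (h : S.Path q u p) : S.rk p ≤ S.rk q := by
  induction u generalizing q with
  | nil => obtain rfl : q = p := h; exact le_rfl
  | cons c u ih => obtain ⟨q', hq, hu⟩ := h; exact (ih hu).trans (S.rk_lt hq).le

theorem Path.ok_mono {q p : Q} {u : List C} (h : S.Path q u p) {d : C} (hd : S.ok d q) :
    S.ok d p := by
  induction u generalizing q with
  | nil => obtain rfl : q = p := h; exact hd
  | cons c u ih => obtain ⟨q', hq, hu⟩ := h; exact ih hu (S.ok_mono hq hd)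

theorem Path.ok_of_mem {q p : Q} {u : List C} (h : S.Path q u p) {d : C} (hd : d ∈ u) :
    S.ok d p := by
  induction u generalizing q with
  | nil => simp at hd
  | cons c u ih =>
    obtain ⟨q', hq, hu⟩ := h
    rcases List.mem_cons.1 hd with rfl | hd
    · exact hu.ok_mono (S.ok_ch hq)
    · exact ih hu hd

variable (S)

/-- The points of the space: nodes placed at addresses made of admissible columns. -/
@[ext]
structure Point where
  /-- The address, a finite sequence of columns. -/
  addr : List C
  /-- The node placed at the address. -/
  node : Q
  ok_addr : ∀ c ∈ addr, S.ok c node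

variable {S}

/-- `x ≤ y` if the address of `x` extends that of `y` by columns leading from the node of `y` to
the node of `x`. -/
instance : PartialOrder S.Point where
  le x y := ∃ u, x.addr = y.addr ++ u ∧ S.Path y.node u x.node
  le_refl x := ⟨[], by simp, rfl⟩
  le_trans := by
    rintro x y z ⟨u, hu, hyx⟩ ⟨v, hv, hzy⟩
    exact ⟨v ++ u, by rw [hu, hv, List.append_assoc], hzy.append hyx⟩
  le_antisymm := by
    rintro x y ⟨u, hu, hyx⟩ ⟨v, hv, hxy⟩
    have hl := congrArg List.length (hv ▸ hu)
    simp only [List.length_append] at hl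
    obtain rfl : u = [] := List.eq_nil_of_length_eq_zero (by omega)
    exact Point.ext (by simpa using hu) hyx.symm

theorem Point.le_def {x y : S.Point} :
    x ≤ y ↔ ∃ u, x.addr = y.addr ++ u ∧ S.Path y.node u x.node := Iff.rfl

theorem Point.exists_cons_of_lt {x y : S.Point} (h : x < y) :
    ∃ c u q, x.addr = y.addr ++ c :: u ∧ S.ch y.node c q ∧ S.Path q u x.node := by
  obtain ⟨⟨u, hu, hyx⟩, hne⟩ := lt_iff_le_and_ne.1 h
  cases u with
  | nil => exact (hne (Point.ext (by simpa using hu) hyx.symm)).elim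
  | cons c u =>
    obtain ⟨q, hq, hqx⟩ := hyx
    exact ⟨c, u, q, hu, hq, hqx⟩

/-- The cones of the node `q` at the empty address and of the node `p` at the address `w` meet in
a countable union of cones. In each column occupied by both the question is the same one for a
child of `q`, and there are countably many such columns unless the points coincide. -/
theorem exists_countable_common (q : Q) (w : List C) (p : Q) :
    ∃ F : Set (List C × Q), F.Countable ∧ ∀ u r,
      (S.Path q u r ∧ ∃ v, u = w ++ v ∧ S.Path p v r) ↔
        ∃ f ∈ F, ∃ v, u = f.1 ++ v ∧ S.Path f.2 v r := by
  induction q using (InvImage.wf S.rk wellFounded_lt).induction generalizing w p with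
  | _ q ih =>
    cases w with
    | nil =>
      by_cases hqp : q = p
      · subst hqp
        exact ⟨{([], q)}, Set.countable_singleton _, fun u r ↦ by simp⟩
      · have hF : ∀ c, ∃ F : Set (List C × Q), F.Countable ∧ ∀ u r,
            (∃ q' p', S.ch q c q' ∧ S.ch p c p' ∧ S.Path q' u r ∧ S.Path p' u r) ↔
              ∃ f ∈ F, ∃ v, u = f.1 ++ v ∧ S.Path f.2 v r := fun c ↦ by
          by_cases hc : (∃ q', S.ch q c q') ∧ ∃ p', S.ch p c p'
          · obtain ⟨⟨q', hq'⟩, p', hp'⟩ := hc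
            obtain ⟨F, hF, hFu⟩ := ih q' (S.rk_lt hq') [] p'
            refine ⟨F, hF, fun u r ↦ Iff.trans ⟨?_, ?_⟩ (hFu u r)⟩
            · rintro ⟨q'', p'', hq'', hp'', hq, hp⟩
              obtain rfl := S.ch_unique hq' hq''
              obtain rfl := S.ch_unique hp' hp''
              exact ⟨hq, u, rfl, hp⟩
            · rintro ⟨hq, v, huv, hp⟩
              obtain rfl : u = v := huv
              exact ⟨q', p', hq', hp', hq, hp⟩
          · refine ⟨∅, Set.countable_empty, fun u r ↦ ?_⟩
            constructor
            · rintro ⟨q', p', hq', hp', -⟩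
              exact (hc ⟨⟨q', hq'⟩, p', hp'⟩).elim
            · rintro ⟨f, hf, -⟩
              exact hf.elim
        choose F hF hFu using hF
        refine ⟨⋃ c ∈ {c | (∃ q', S.ch q c q') ∧ ∃ p', S.ch p c p'},
          (fun f ↦ (c :: f.1, f.2)) '' F c,
          (S.countable_common q p hqp).biUnion fun c _ ↦ (hF c).image _, fun u r ↦ ?_⟩
        constructor
        · rintro ⟨hqu, v, huv, hpv⟩
          obtain rfl : u = v := huv
          cases u with
          | nil => exact (hqp (hqu.trans hpv.symm)).elim
          | cons c v =>
            obtain ⟨q', hq', hq⟩ := hqu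
            obtain ⟨p', hp', hp⟩ := hpv
            obtain ⟨f, hf, v', hv, hr⟩ := (hFu c v r).1 ⟨q', p', hq', hp', hq, hp⟩
            exact ⟨_, Set.mem_biUnion (show c ∈ {c | _} from ⟨⟨q', hq'⟩, p', hp'⟩)
              ⟨f, hf, rfl⟩, v', by simp [hv], hr⟩
        · rintro ⟨_, hf, v, rfl, hr⟩
          obtain ⟨c, -, f, hfc, rfl⟩ := Set.mem_iUnion₂.1 hf
          obtain ⟨q', p', hq', hp', hq, hp⟩ := (hFu c _ r).2 ⟨f, hfc, v, rfl, hr⟩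
          exact ⟨⟨q', hq', hq⟩, _, rfl, p', hp', hp⟩
    | cons c w =>
      by_cases hc : ∃ q', S.ch q c q'
      · obtain ⟨q', hq'⟩ := hc
        obtain ⟨F, hF, hFu⟩ := ih q' (S.rk_lt hq') w p
        refine ⟨(fun f ↦ (c :: f.1, f.2)) '' F, hF.image _, fun u r ↦ ?_⟩
        constructor
        · rintro ⟨hqu, v, rfl, hp⟩
          obtain ⟨q'', hq'', hq⟩ := hqu
          obtain rfl := S.ch_unique hq' hq''
          obtain ⟨f, hf, v', hv, hr⟩ := (hFu _ r).1 ⟨hq, v, rfl, hp⟩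
          exact ⟨_, ⟨f, hf, rfl⟩, v', congrArg (c :: ·) hv, hr⟩
        · rintro ⟨_, ⟨f, hf, rfl⟩, v, rfl, hr⟩
          obtain ⟨hq, v', hv, hp⟩ := (hFu _ r).2 ⟨f, hf, v, rfl, hr⟩
          exact ⟨⟨q', hq', hq⟩, v', by simp [hv], hp⟩
      · refine ⟨∅, Set.countable_empty, fun u r ↦ ?_⟩
        constructor
        · rintro ⟨hqu, v, rfl, -⟩
          obtain ⟨q', hq', -⟩ := hqu
          exact (hc ⟨q', hq'⟩).elim
        · rintro ⟨f, hf, -⟩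
          exact hf.elim

/-- Two cones with comparable addresses meet in a countable union of cones: a consequence of
`ColumnSystem.exists_countable_common` after cancelling the common part of the addresses. -/
theorem Point.exists_countable_inter_of_prefix {x y : S.Point} (hxy : x.addr <+: y.addr) :
    ∃ F : Set S.Point, F.Countable ∧ ∀ z, (z ≤ x ∧ z ≤ y) ↔ ∃ w ∈ F, z ≤ w := by
  obtain ⟨w, hw⟩ := hxy
  obtain ⟨F, hF, hFu⟩ := exists_countable_common (S := S) x.node w y.node
  refine ⟨{f | ∃ g ∈ F, f.addr = x.addr ++ g.1 ∧ f.node = g.2}, ?_, fun z ↦ ?_⟩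
  · refine (hF.image fun g ↦ (x.addr ++ g.1, g.2)).preimage_of_injOn
      (f := fun f : S.Point ↦ (f.addr, f.node)) ?_ |>.mono ?_
    · rintro f - f' - h
      exact Point.ext (congrArg Prod.fst h) (congrArg Prod.snd h)
    · rintro f ⟨g, hg, h1, h2⟩
      exact ⟨g, hg, Prod.ext h1.symm h2.symm⟩
  · constructor
    · rintro ⟨⟨u, hu, hx⟩, v, hv, hy⟩
      have huv : u = w ++ v := by
        rw [hu, ← hw, List.append_assoc] at hv
        exact List.append_cancel_left hv
      obtain ⟨g, hg, v', hv', hr⟩ := (hFu u z.node).1 ⟨hx, v, huv, hy⟩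
      -- The point over `g` lies below `x`, so its address is admissible.
      obtain ⟨hxg, -⟩ := (hFu g.1 g.2).2 ⟨g, hg, [], by simp, rfl⟩
      refine ⟨⟨x.addr ++ g.1, g.2, fun c hc ↦ ?_⟩, ⟨g, hg, rfl, rfl⟩, v', ?_, hr⟩
      · rcases List.mem_append.1 hc with hc | hc
        · exact hxg.ok_mono (x.ok_addr c hc)
        · exact hxg.ok_of_mem hc
      · rw [hu, hv', List.append_assoc]
    · rintro ⟨f, ⟨g, hg, h1, h2⟩, v, hv, hr⟩
      rw [h2] at hr
      obtain ⟨hx, v', hv', hy⟩ := (hFu (g.1 ++ v) z.node).2 ⟨g, hg, v, rfl, hr⟩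
      refine ⟨⟨_, by rw [hv, h1, List.append_assoc], hx⟩, v', ?_, hy⟩
      rw [hv, h1, List.append_assoc, hv', ← hw, List.append_assoc]

theorem Point.exists_countable_inter (x y : S.Point) : ∃ F : Set S.Point, F.Countable ∧
    ∀ z, (z ≤ x ∧ z ≤ y) ↔ ∃ w ∈ F, z ≤ w := by
  by_cases hxy : x.addr <+: y.addr
  · exact exists_countable_inter_of_prefix hxy
  by_cases hyx : y.addr <+: x.addr
  · obtain ⟨F, hF, h⟩ := exists_countable_inter_of_prefix hyx
    exact ⟨F, hF, fun z ↦ and_comm.trans (h z)⟩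
  · refine ⟨∅, Set.countable_empty, fun z ↦ ⟨?_, fun ⟨w, hw, _⟩ ↦ hw.elim⟩⟩
    rintro ⟨⟨u, hu, -⟩, v, hv, -⟩
    rcases List.prefix_or_prefix_of_prefix ⟨u, hu.symm⟩ ⟨v, hv.symm⟩ with h | h
    · exact (hxy h).elim
    · exact (hyx h).elim

theorem Point.mk_node_mem_le {N : Set Q} {T : Set C} (h : ∀ q ∈ N, ∀ c, S.ok c q → c ∈ T) :
    #{x : S.Point | x.node ∈ N} ≤ max ℵ₀ #T * #N := by
  let f : S.Point → List C × Q := fun x ↦ (x.addr, x.node)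
  let j : List T × N → List C × Q := fun y ↦ (y.1.map (↑), y.2)
  have hf : Function.Injective f := fun x y hxy ↦
    Point.ext (congrArg Prod.fst hxy) (congrArg Prod.snd hxy)
  have hsub : f '' {x | x.node ∈ N} ⊆ Set.range j := by
    rintro _ ⟨x, hx, rfl⟩
    have hl : x.addr ∈ Set.range (List.map ((↑) : T → C)) := by
      rw [Set.range_list_map_coe]
      exact fun c hc ↦ h x.node hx c (x.ok_addr c hc)
    obtain ⟨l, hl⟩ := hl
    exact ⟨(l, ⟨x.node, hx⟩), Prod.ext hl rfl⟩
  calc #{x : S.Point | x.node ∈ N} = #(f '' {x | x.node ∈ N}) := (mk_image_eq hf).symm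
    _ ≤ #(List T × N) := (mk_le_mk_of_subset hsub).trans mk_range_le
    _ ≤ max ℵ₀ #T * #N := by
      rw [mk_prod, Cardinal.lift_id, Cardinal.lift_id]
      exact mul_le_mul_left (mk_list_le_max T) _

theorem isConeSystem {o : Ordinal.{u}} (ho : ∀ q, S.rk q < o) :
    IsConeSystem S.Point (fun x ↦ S.rk x.node) o where
  rk_lt x := ho x.node
  strictMono x y hxy := by
    obtain ⟨c, u, q, -, hq, hp⟩ := Point.exists_cons_of_lt hxy
    exact hp.rk_le.trans_lt (S.rk_lt hq)
  inter := Point.exists_countable_inter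
  dense x α hα F hF hFx := by
    -- A child of `x` in a column through which no point of `F` passes is not below `F`.
    have hcol : {c | ∃ z ∈ F, z.addr[x.addr.length]? = some c}.Countable := by
      refine ((hF.image fun z ↦ z.addr[x.addr.length]?).preimage
        (Option.some_injective C)).mono ?_
      rintro c ⟨z, hz, h⟩
      exact ⟨z, hz, h⟩
    obtain ⟨c, ⟨p, hp, hch⟩, hc⟩ := Set.not_subset.1
      fun h ↦ S.not_countable_ch x.node α hα (hcol.mono h)
    refine ⟨⟨x.addr ++ [c], p, fun d hd ↦ ?_⟩, ⟨[c], rfl, p, hch, rfl⟩, hp, ?_⟩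
    · rcases List.mem_append.1 hd with hd | hd
      · exact S.ok_mono hch (x.ok_addr d hd)
      · obtain rfl := List.mem_singleton.1 hd
        exact S.ok_ch hch
    · rintro z hz ⟨v, hv, -⟩
      obtain ⟨d, u, q, hu, -⟩ := Point.exists_cons_of_lt (hFx hz)
      refine hc ⟨z, hz, ?_⟩
      have hv : x.addr ++ [c] = z.addr ++ v := hv
      rw [hu, List.append_assoc] at hv
      have := List.append_cancel_left hv
      simp only [List.cons_append, List.cons.injEq] at this
      simp [hu, this.1]

end ColumnSystem

/-! ### Almost disjoint families of functions -/

/-- A well-ordered family of functions on `W`, any two of which agree at countably many places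
only. Each function differs at `m` from the countably many earlier ones whose code is below `m`. -/
theorem exists_eventually_different {Ω W : Type u} [LinearOrder Ω] [WellFoundedLT Ω]
    [LinearOrder W] [Uncountable W] (hW : ∀ m : W, (Set.Iio m).Countable)
    (e : ∀ γ : Ω, Set.Iio γ → W) (he : ∀ γ, Function.Injective (e γ)) :
    ∃ g : Ω → W → W, ∀ γ δ, γ ≠ δ → {m | g γ m = g δ m}.Countable := by
  have hstep : ∀ (γ : Ω) (f : ∀ δ, δ < γ → W → W) (m : W), ∃ w, ∀ δ (h : δ < γ),
      e γ ⟨δ, h⟩ < m → w ≠ f δ h m := fun γ f m ↦ by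
    have hc : ((fun δ : Set.Iio γ ↦ f δ.1 δ.2 m) '' (e γ ⁻¹' Set.Iio m)).Countable :=
      ((hW m).preimage (he γ)).image _
    obtain ⟨w, -, hw⟩ := Set.not_subset.1 fun h ↦
      Set.not_countable_univ (hc.mono (h : Set.univ ⊆ _))
    exact ⟨w, fun δ h hδ hwδ ↦ hw ⟨⟨δ, h⟩, hδ, hwδ.symm⟩⟩
  choose step hstep using hstep
  have wf : WellFounded ((· < ·) : Ω → Ω → Prop) := wellFounded_lt
  let g : Ω → W → W := wf.fix step
  have hg : ∀ γ δ (h : δ < γ) m, e γ ⟨δ, h⟩ < m → g γ m ≠ g δ m := fun γ δ h m hm ↦ by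
    have := hstep γ (fun δ _ ↦ g δ) m δ h hm
    rwa [show g γ = step γ fun δ _ ↦ g δ from wf.fix_eq step γ]
  have key : ∀ γ δ, δ < γ → {m | g γ m = g δ m}.Countable := fun γ δ h ↦ by
    refine ((hW (e γ ⟨δ, h⟩)).insert (e γ ⟨δ, h⟩)).mono fun m hm ↦ ?_
    rw [Set.Iio_insert]
    by_contra hlt
    exact hg γ δ h m (not_le.1 hlt) hm
  refine ⟨g, fun γ δ hne ↦ ?_⟩
  rcases lt_or_gt_of_ne hne with h | h
  · exact (key δ γ h).mono fun m hm ↦ Eq.symm hm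
  · exact key γ δ h

/-- Below `𝔸(κ, ℵ₁)` there are almost disjoint families; enumerating their members injectively
makes them functions that agree at countably many places only. -/
theorem exists_functions_of_lt_almostDisjointNumber {κ μ : Cardinal.{u}}
    (h : μ < almostDisjointNumber κ ℵ₁) {W : Type u} (hW : #W = ℵ₁) :
    ∃ a : μ.out → W → κ.out, ∀ ξ η, ξ ≠ η → {m | a ξ m = a η m}.Countable := by
  have hμ := notMem_of_lt_csInf' h
  simp only [Set.mem_ofPred_eq, not_forall, not_exists, not_and] at hμ
  obtain ⟨F, hF, hFμ, hdisj⟩ := hμ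
  obtain ⟨i⟩ : Nonempty (μ.out ≃ F) := by rw [← Cardinal.eq, mk_out, hFμ]
  have he : ∀ A : F, Nonempty (W ≃ A.1) := fun A ↦ by rw [← Cardinal.eq, hW, hF A.1 A.2]
  have e : ∀ A : F, W ≃ A.1 := fun A ↦ (he A).some
  refine ⟨fun ξ m ↦ (e (i ξ) m).1, fun ξ η hne ↦ ?_⟩
  have hsub : (fun m ↦ (e (i ξ) m).1) '' {m | (e (i ξ) m).1 = (e (i η) m).1} ⊆
      (i ξ).1 ∩ (i η).1 := by
    rintro _ ⟨m, hm, rfl⟩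
    have hm : (e (i ξ) m).1 = (e (i η) m).1 := hm
    exact ⟨(e (i ξ) m).2, hm.symm.subst (motive := (· ∈ (i η).1)) (e (i η) m).2⟩
  have hlt : #((i ξ).1 ∩ (i η).1 : Set κ.out) < ℵ₁ := by
    refine lt_of_le_of_ne ((mk_le_mk_of_subset Set.inter_subset_left).trans
      (hF _ (i ξ).2).le) (hdisj _ (i ξ).2 _ (i η).2 fun h ↦ hne (i.injective (Subtype.ext h)))
  rw [← succ_aleph0, Order.lt_succ_iff, le_aleph0_iff_set_countable] at hlt
  exact Set.countable_of_injective_of_countable_image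
    (Subtype.val_injective.comp (e (i ξ)).injective).injOn (hlt.mono hsub)

/-! ### Realizing cardinal sequences -/

theorem exists_map_to_initial_segment {c d : Cardinal.{u}} (h : d ≤ c) :
    ∃ f : d.out → c.ord.ToType, Function.Injective f ∧
      ∀ x, (ToType.toOrd (f x) : Ordinal.{u}) < d.ord := by
  obtain ⟨i⟩ : Nonempty (d.out ≃ d.ord.ToType) := by simp [← Cardinal.eq]
  have hlt : ∀ x, (ToType.toOrd (i x) : Ordinal.{u}) < c.ord := fun x ↦
    (Set.mem_Iio.1 (ToType.toOrd (i x)).2).trans_le (ord_le_ord.2 h)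
  refine ⟨fun x ↦ ToType.mk ⟨(ToType.toOrd (i x) : Ordinal.{u}), hlt x⟩, fun x y hxy ↦ ?_, fun x ↦ ?_⟩
  · have := congrArg Subtype.val (ToType.mk.injective hxy)
    exact i.injective (ToType.mk.symm.injective (Subtype.ext this))
  · have : ToType.toOrd (ToType.mk ⟨(ToType.toOrd (i x) : Ordinal.{u}), hlt x⟩) =
        ⟨(ToType.toOrd (i x) : Ordinal.{u}), hlt x⟩ := ToType.mk.symm_apply_apply _
    exact (congrArg Subtype.val this).trans_lt (ToType.toOrd (i x)).2

theorem mk_initial_segment_le {c d : Cardinal.{u}} :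
    #{z : c.ord.ToType | (ToType.toOrd z : Ordinal.{u}) < d.ord} ≤ d := by
  have : Function.Injective
      (fun z : {z : c.ord.ToType | (ToType.toOrd z : Ordinal.{u}) < d.ord} ↦
        (ToType.mk ⟨(ToType.toOrd z.1 : Ordinal.{u}), z.2⟩ : d.ord.ToType)) := by
    intro x y hxy
    have := congrArg Subtype.val (ToType.mk.injective hxy)
    exact Subtype.ext (ToType.mk.symm.injective (Subtype.ext this))
  simpa using mk_le_of_injective this

/-- Functions attached to the nodes of level `γ`, with values in the part of `c.ord.ToType` below
all `κ δ`, `δ < γ`: they live on a set of the least cardinality among these `κ δ`. -/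
theorem exists_level_functions {Ω W : Type u} [LinearOrder Ω] (κ : Ω → Cardinal.{u})
    (c : Cardinal.{u}) (hκc : ∀ γ, κ γ ≤ c) (hκ : ∀ γ, κ γ ≠ 0) (hW : #W = ℵ₁)
    (h : ∀ α β, α < β → κ β < almostDisjointNumber (κ α) ℵ₁) (γ : Ω) :
    ∃ a : (κ γ).out → W → c.ord.ToType,
      (∀ δ < γ, ∀ ξ η, ξ ≠ η → {m | a ξ m = a η m}.Countable) ∧
      ∀ ξ m, ∀ δ < γ, (ToType.toOrd (a ξ m) : Ordinal.{u}) < (κ δ).ord := by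
  by_cases hγ : (Set.Iio γ).Nonempty
  · have hne : (κ '' Set.Iio γ).Nonempty := hγ.image κ
    obtain ⟨α, hα, hmin⟩ := csInf_mem hne
    obtain ⟨a, ha⟩ := exists_functions_of_lt_almostDisjointNumber (h α γ hα) hW
    obtain ⟨f, hf, hfα⟩ := exists_map_to_initial_segment (hκc α)
    refine ⟨fun ξ m ↦ f (a ξ m), fun _ _ ξ η hne ↦ ?_, fun ξ m δ hδ ↦ ?_⟩
    · simpa only [hf.eq_iff] using ha ξ η hne
    · refine (hfα _).trans_le (ord_le_ord.2 ?_)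
      rw [hmin]
      exact csInf_le' ⟨δ, hδ, rfl⟩
  · have hc : c ≠ 0 := fun h0 ↦ hκ γ (le_zero_iff.1 (h0 ▸ hκc γ))
    have : Nonempty c.ord.ToType := by simpa [nonempty_toType_iff] using hc
    exact ⟨fun _ _ ↦ Classical.arbitrary _, fun δ hδ ↦ (hγ ⟨δ, hδ⟩).elim,
      fun _ _ δ hδ ↦ (hγ ⟨δ, hδ⟩).elim⟩

/-- The column system realizing the sequence `κ`. The nodes of level `γ` are the elements of
`(κ γ).out`. A column is a triple `(z, w, m)`; the node `ξ` of level `γ` uses the columns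
`(a γ ξ m, g γ m, m)`, where `m` codes a level `δ < γ` and an element of `W`, and its child there is
a fixed node of level `δ`. The functions `g γ` make nodes of distinct levels share countably many
columns, and the functions `a γ ξ` do so for nodes of the same level. The column `(z, w, m)` is admissible at
level `γ` if `ρ z` lies below the initial ordinals of all `κ δ`, `δ ≤ γ`, which bounds the number
of addresses at level `γ`. -/
noncomputable def levelColumnSystem {o : Ordinal.{u}} (κ : o.ToType → Cardinal.{u})
    (base : ∀ γ, (κ γ).out) {W Z : Type u} (hW : Uncountable W) (ρ : Z → Ordinal.{u})
    (E : ∀ γ : o.ToType, Set.Iio γ × W → W) (hE : ∀ γ, Function.Injective (E γ))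
    (g : o.ToType → W → W) (hg : ∀ γ δ, γ ≠ δ → {m | g γ m = g δ m}.Countable)
    (a : ∀ γ, (κ γ).out → W → Z)
    (ha : ∀ γ, ∀ δ < γ, ∀ ξ η, ξ ≠ η → {m | a γ ξ m = a γ η m}.Countable)
    (haρ : ∀ γ ξ m, ∀ δ < γ, ρ (a γ ξ m) < (κ δ).ord) :
    ColumnSystem (Σ γ, (κ γ).out) (Z × W × W) where
  rk q := ToType.toOrd q.1
  ch q c p := ∃ (h : p.1 < q.1) (k : W),
    p.2 = base p.1 ∧
    c = (a q.1 q.2 (E q.1 (⟨p.1, h⟩, k)), g q.1 (E q.1 (⟨p.1, h⟩, k)), E q.1 (⟨p.1, h⟩, k))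
  ok c q := ∀ δ ≤ q.1, ρ c.1 < (κ δ).ord
  ch_unique := by
    rintro ⟨γ, ξ⟩ c ⟨δ, η⟩ ⟨δ', η'⟩ ⟨h, k, hη, rfl⟩ ⟨h', k', hη', hc⟩
    have := hE γ (congrArg (fun c ↦ c.2.2) hc)
    obtain rfl : δ = δ' := congrArg (fun p ↦ p.1.1) this
    exact Sigma.ext rfl (heq_of_eq (hη.trans hη'.symm))
  rk_lt := by
    rintro q c p ⟨h, -⟩
    simpa using h
  ok_ch := by
    rintro q c p ⟨h, k, -, rfl⟩ δ hδ
    exact haρ _ _ _ _ (hδ.trans_lt h)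
  ok_mono := by
    rintro q c p d ⟨h, -⟩ hd δ hδ
    exact hd δ (hδ.trans h.le)
  countable_common := by
    rintro ⟨γ, ξ⟩ ⟨γ', ξ'⟩ hne
    by_cases hγ : γ = γ'
    · subst hγ
      have hξ : ξ ≠ ξ' := fun h ↦ hne (h ▸ rfl)
      by_cases hpos : ∃ δ, δ < γ
      · obtain ⟨δ, hδ⟩ := hpos
        refine ((ha γ δ hδ ξ ξ' hξ).image fun m ↦ (a γ ξ m, g γ m, m)).mono ?_
        rintro _ ⟨⟨p, h, k, -, rfl⟩, p', h', k', -, hc⟩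
        have h1 := congrArg (fun c ↦ c.1) hc
        have h2 := congrArg (fun c ↦ c.2.2) hc
        dsimp only at h1 h2
        rw [← h2] at h1
        exact ⟨_, h1, rfl⟩
      · refine Set.countable_empty.mono ?_
        rintro _ ⟨⟨p, h, -⟩, -⟩
        exact hpos ⟨_, h⟩
    · refine ((hg γ γ' hγ).image fun m ↦ (a γ ξ m, g γ m, m)).mono ?_
      rintro _ ⟨⟨p, h, k, -, rfl⟩, p', h', k', -, hc⟩
      have h1 := congrArg (fun c ↦ c.2.1) hc
      have h2 := congrArg (fun c ↦ c.2.2) hc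
      dsimp only at h1 h2
      rw [← h2] at h1
      exact ⟨_, h1, rfl⟩
  not_countable_ch := by
    rintro ⟨γ, ξ⟩ α hα hcount
    have hα' : α < ToType.toOrd γ := hα
    obtain ⟨δ, rfl⟩ : ∃ δ : o.ToType, (ToType.toOrd δ : Ordinal.{u}) = α :=
      ⟨ToType.mk ⟨α, hα'.trans (ToType.toOrd γ).2⟩, by simp⟩
    have h : δ < γ := by simpa using hα'
    have hinj : Function.Injective fun k : W ↦ ((a γ ξ (E γ (⟨δ, h⟩, k)),
        g γ (E γ (⟨δ, h⟩, k)), E γ (⟨δ, h⟩, k)) : Z × W × W) := fun k k' hk ↦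
      congrArg Prod.snd (hE γ (congrArg (fun c ↦ c.2.2) hk))
    refine Set.not_countable_univ ((hcount.preimage hinj).mono fun k _ ↦ ?_)
    exact ⟨⟨δ, base δ⟩, rfl, h, k, rfl, rfl⟩

theorem isLLSPCardinalSequence_of_lt_almostDisjointNumber
    (κ : Set.Iio (ω_ 2 : Ordinal.{u}) → Cardinal.{u}) (hκ : ∀ α, ℵ₀ < κ α)
    (h : ∀ α β, α < β → κ β < almostDisjointNumber (κ α) ℵ₁) :
    IsLLSPCardinalSequence κ := by
  let Ω : Type u := (ω_ 2 : Ordinal.{u}).ToType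
  let W : Type u := (ℵ₁ : Cardinal.{u}).ord.ToType
  let κ' : Ω → Cardinal.{u} := fun γ ↦ κ (ToType.toOrd γ)
  have hW : #W = ℵ₁ := mk_ord_toType _
  have hWu : Uncountable W := by
    rw [← aleph0_lt_mk_iff, hW]
    exact aleph0_lt_aleph_one
  have hWc : ∀ m : W, (Set.Iio m).Countable := fun m ↦ by
    rw [← le_aleph0_iff_set_countable, ← Order.lt_succ_iff, succ_aleph0]
    exact (mk_Iio_lt m (by simp [W])).trans_eq hW
  have hΩ : ∀ γ : Ω, #(Set.Iio γ) ≤ ℵ₁ := fun γ ↦ by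
    have hlt : #(Set.Iio γ) < #Ω := mk_Iio_lt γ (by simp [Ω, ← ord_aleph])
    have h2 : #Ω = Order.succ ℵ₁ := by
      rw [mk_toType, card_omega, succ_aleph, one_add_one_eq_two]
    rwa [h2, Order.lt_succ_iff] at hlt
  -- Each level below `γ` receives uncountably many codes in `W`.
  have hE : ∀ γ : Ω, ∃ E : Set.Iio γ × W → W, Function.Injective E := fun γ ↦ by
    have hle : #(Set.Iio γ × W) ≤ #W := by
      rw [mk_prod, Cardinal.lift_id, Cardinal.lift_id, hW]
      exact (mul_le_mul_left (hΩ γ) _).trans (mul_eq_self (aleph0_le_aleph 1)).le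
    obtain ⟨E⟩ := (le_def _ _).1 hle
    exact ⟨E, E.injective⟩
  choose E hE using hE
  obtain ⟨w₀⟩ : Nonempty W := inferInstance
  obtain ⟨g, hg⟩ := exists_eventually_different hWc (fun γ δ ↦ E γ (δ, w₀))
    (fun γ δ δ' hδ ↦ congrArg Prod.fst (hE γ hδ))
  let c : Cardinal.{u} := Cardinal.sum κ'
  have hc : ∀ γ, κ' γ ≤ c := fun γ ↦ le_sum κ' γ
  have hκ1 : ∀ γ, ℵ₁ ≤ κ' γ := fun γ ↦ by
    rw [← succ_aleph0, Order.succ_le_iff]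
    exact hκ _
  have hκ0 : ∀ γ, κ' γ ≠ 0 := fun γ ↦ (aleph0_pos.trans (hκ _)).ne'
  choose a ha haρ using exists_level_functions κ' c hc hκ0 hW (fun α β hαβ ↦ h _ _ (by simpa))
  have hbase : ∀ γ, Nonempty (κ' γ).out := fun γ ↦
    mk_ne_zero_iff.1 ((mk_out (κ' γ)).trans_ne (hκ0 γ))
  let S := levelColumnSystem κ' (fun γ ↦ (hbase γ).some) hWu (fun z : c.ord.ToType ↦ ToType.toOrd z) E hE g hg a
    ha haρ
  refine (S.isConeSystem (o := ω_ 2) fun q ↦ (ToType.toOrd q.1).2).isLLSPCardinalSequence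
    (fun α ↦ (hκ α).le) fun α ↦ ?_
  obtain ⟨γ, rfl⟩ : ∃ γ : Ω, ToType.toOrd γ = α := ToType.mk.symm.surjective α
  change #{x : S.Point | (ToType.toOrd x.node.1 : Ordinal.{u}) = ToType.toOrd γ} = κ' γ
  have hset : {x : S.Point | (ToType.toOrd x.node.1 : Ordinal.{u}) = ToType.toOrd γ} =
      {x | x.node ∈ {q | q.1 = γ}} := by
    ext x
    exact (Subtype.val_injective.comp ToType.mk.symm.injective).eq_iff
  rw [hset]
  have hN : #{q : Σ γ, (κ' γ).out | q.1 = γ} = κ' γ := by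
    rw [← mk_out (κ' γ)]
    exact mk_congr (Equiv.sigmaSubtype γ)
  refine le_antisymm ?_ ?_
  · let T : Set (c.ord.ToType × W × W) :=
      {z | (ToType.toOrd z : Ordinal.{u}) < (κ' γ).ord} ×ˢ Set.univ
    have hT : #T ≤ κ' γ := by
      rw [mk_setProd, mk_univ, mk_prod, Cardinal.lift_id, hW]
      exact mul_le_of_le (hκ _).le mk_initial_segment_le
        (mul_le_of_le (hκ _).le (hκ1 _) (hκ1 _))
    refine (ColumnSystem.Point.mk_node_mem_le (T := T) ?_).trans ?_
    · rintro q rfl z hz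
      exact ⟨hz q.1 le_rfl, trivial⟩
    · rw [hN]
      exact mul_le_of_le (hκ _).le (max_le (hκ _).le hT) le_rfl
  · have hinj : Function.Injective fun ξ : (κ' γ).out ↦
        (⟨⟨[], ⟨γ, ξ⟩, by simp⟩, rfl⟩ : {x : S.Point | x.node ∈ {q | q.1 = γ}}) := fun ξ η hξη ↦ by
      simpa using hξη
    exact (mk_out (κ' γ)).ge.trans (mk_le_of_injective hinj)

theorem mainTheorem1 (κ : Set.Iio (ω_ 2 : Ordinal.{u}) → Cardinal.{u})
    (hκ : ∀ α, ℵ₀ < κ α) :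
    ((∀ α β, α < β → κ β < almostDisjointNumber (κ α) ℵ₁) → IsLLSPCardinalSequence κ) ∧
    (IsLLSPCardinalSequence κ → ∀ α β, α < β → κ β < countableCoverNumber (κ α) (κ α)) :=
  ⟨isLLSPCardinalSequence_of_lt_almostDisjointNumber κ hκ,
    fun h _ _ hαβ ↦ lt_countableCoverNumber_of_isLLSPCardinalSequence h hαβ⟩
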